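/- **Proposition (Adai escapes saddle points).** Let $c\in\mathbb{R}^n$ be a critical point (for instance a saddle point) of a loss $L:\mathbb{R}^n\to\mathbb{R}$ such that $L(\theta)=L(c)+\tfrac12(\theta-c)^\top H(\theta-c)$ for $\theta$ near $c$, where $H$ is the Hessian of $L$ at $c$. Let $H=U\,\mathrm{diag}(H_1,\dots,H_n)U^\top$ with $U$ orthogonal and $[H]^+=U\,\mathrm{diag}(|H_1|,\dots,|H_n|)U^\top$. Let $\eta>0$ be the learning rate, $B\ge 1$ the batch size and $\beta_0>0$. Let the gradient noise near $c$ have covariance $C=\frac1B[H]^+$ and diffusion matrix $D=\frac{\eta}{2}C$. Fix an orthonormal frame of $\mathbb{R}^n$ (for instance the standard one, or the columns of $U$), and let indices $i$ refer to this frame. By the diagonal approximation, put $v_i=C_{ii}$ and $D_i=D_{ii}$, assume $v_i>0$ for all $i$, and put $\bar v=\frac1n\sum_i v_i$. Adai has the inertia $\beta_{1,i}=1-\frac{\beta_0}{\bar v}v_i$ and, in continuous time, the mass $M_i=\eta(1-\beta_{1,i})^{-1}$ and the damping $\gamma_i=\eta^{-1}(1-\beta_{1,i})$. Let $$P_{eq}(r)=(2\pi)^{-n/2}\det(\beta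 M)^{1/2}\exp\!\big(-\tfrac12 r^\top\beta M r\big),\qquad \beta_i=\gamma_iM_iD_i^{-1}.$$ Then $P_{eq}$ is a probability density and a stationary solution of the Fokker–Planck equation $\partial_tP=\nabla_r\cdot(\gamma rP)+\nabla_r\cdot(M^{-2}D\nabla_rP)$ of the velocity, where $D$ stands for $\mathrm{diag}(D_i)$. Let $r_{eq,i}=\big(\int r_i^2P_{eq}(r)\,dr\big)^{1/2}$. The momentum drift is the noise-free motion $\theta(t)$ with $M_i\ddot\theta_i=-\gamma_iM_i\dot\theta_i$ for $t\ge 0$, $\theta(0)=c$ and $\dot\theta_i(0)=r_{eq,i}$ (the gradient near $c$ being neglected). It exists, and with $\Delta\theta_i(t)=\theta_i(t)-\theta_i(0)$ the total momentum drift $\langle\Delta\theta_i\rangle^2:=\lim_{t\to\infty}\Delta\theta_i(t)^2$ in the procedure of passing through $c$ is, for every coordinate $i$, $$\langle\Delta\theta_i\rangle^2=\frac{\bar v\,\eta^2}{2\beta_0}=\frac{\sum_{j=1}^n|H_j|\,\eta^2}{2\beta_0nB}.$$ In particular it depends on the Hessian only through its trace norm $\sum_j|H_j|$ and is the same in every coordinate.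 -/

import Mathlib

open MeasureTheory Filter Topology

noncomputable section

namespace AdaiDynamics

/-- The parameter space `ℝⁿ` with its Euclidean structure. -/
abbrev Param (n : ℕ) : Type := EuclideanSpace ℝ (Fin n)

variable {n : ℕ}

/-! ### The loss near a critical point -/

/-- The Hessian of the loss `L` at `θ`, as a linear operator: the derivative of the gradient. -/
def hessian (L : Param n → ℝ) (θ : Param n) : Param n →L[ℝ] Param n :=
  fderiv ℝ (fun x => gradient L x) θ

/-- `c` is a critical point of `L`. -/
def IsCriticalPoint (L : Param n → ℝ) (c : Param n) : Prop :=
  DifferentiableAt ℝ L c ∧ gradient L c = 0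

/-- Around `c` the loss is its second order Taylor polynomial:
`L(θ) = L(c) + ½ (θ - c)ᵀ H(c) (θ - c)`. -/
def IsQuadraticNear (L : Param n → ℝ) (c : Param n) : Prop :=
  ∀ᶠ θ in 𝓝 c, L θ = L c + 1 / 2 * inner ℝ (θ - c) (hessian L c (θ - c))

/-- `T = U diag(h₁, …, hₙ) Uᵀ`, where the columns of `U` are the orthonormal vectors `u k`. -/
def IsEigendecomposition (T : Param n →L[ℝ] Param n)
    (u : OrthonormalBasis (Fin n) ℝ (Param n)) (h : Fin n → ℝ) : Prop :=
  ∀ k, T (u k) = h k • u k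

/-- `[T]⁺ = U diag(|h₁|, …, |hₙ|) Uᵀ` for an operator `T = U diag(h₁, …, hₙ) Uᵀ`. -/
def absOperator (u : OrthonormalBasis (Fin n) ℝ (Param n)) (h : Fin n → ℝ) :
    Param n →L[ℝ] Param n :=
  ∑ k, |h k| • (innerSL ℝ (u k)).smulRight (u k)

/-! ### Gradient noise and the coefficients of Adai -/

/-- Covariance `C = [H]⁺ / B` of the minibatch gradient noise near the critical point, for the
batch size `B`. -/
def noiseCovariance (B : ℕ) (u : OrthonormalBasis (Fin n) ℝ (Param n)) (h : Fin n → ℝ) :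
    Param n →L[ℝ] Param n :=
  (B : ℝ)⁻¹ • absOperator u h

/-- Diffusion matrix `D = η C / 2`. -/
def diffusion (η : ℝ) (C : Param n →L[ℝ] Param n) : Param n →L[ℝ] Param n :=
  (η / 2) • C

/-- The diagonal entries of a matrix in the orthonormal frame `b` (the diagonal approximation). -/
def diagIn (b : OrthonormalBasis (Fin n) ℝ (Param n)) (T : Param n →L[ℝ] Param n) :
    Fin n → ℝ :=
  fun i => inner ℝ (b i) (T (b i))

/-- The mean `v̄` of all the elements of `v`. -/
def mean (v : Fin n → ℝ) : ℝ := (∑ i, v i) / n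

/-- The parameter-wise inertia of Adai, `β₁ = 1 - (β₀ / v̄) v`. -/
def inertia (β₀ : ℝ) (v : Fin n → ℝ) : Fin n → ℝ :=
  fun i => 1 - β₀ / mean v * v i

/-- The diagonal of the mass matrix, `M = η (I - diag β₁)⁻¹`. -/
def mass (η : ℝ) (β₁ : Fin n → ℝ) : Fin n → ℝ := fun i => η * (1 - β₁ i)⁻¹

/-- The diagonal of the damping matrix, `γ = η⁻¹ (I - diag β₁)`. -/
def damping (η : ℝ) (β₁ : Fin n → ℝ) : Fin n → ℝ := fun i => η⁻¹ * (1 - β₁ i)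

/-! ### The equilibrium velocity distribution -/

/-- The inverse temperature `β = γ M D⁻¹` (diagonal matrices). -/
def invTemperature (γ M D : Fin n → ℝ) : Fin n → ℝ := fun i => γ i * M i * (D i)⁻¹

/-- `P_eq(r) = (2π)^(-n/2) det(β M)^(1/2) exp(- rᵀ β M r / 2)`; the `r i` are the components of
the velocity in the frame. -/
def equilibriumDensity (γ M D : Fin n → ℝ) (r : Fin n → ℝ) : ℝ :=
  (2 * Real.pi) ^ (-((n : ℝ) / 2)) * Real.sqrt (∏ i, invTemperature γ M D i * M i) *
    Real.exp (-(∑ i, invTemperature γ M D i * M i * r i ^ 2) / 2)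

/-- The partial derivative `∂g/∂rᵢ`. -/
def partialDeriv (i : Fin n) (g : (Fin n → ℝ) → ℝ) (r : Fin n → ℝ) : ℝ :=
  deriv (fun s => g (Function.update r i s)) (r i)

/-- `p` is a probability density which is a stationary solution of the Fokker-Planck equation
`∂P/∂t = ∇ᵣ · (γ r P) + ∇ᵣ · (M⁻² D ∇ᵣ P)` of the velocity equation
`M dr = - γ M r dt + (2 D)^(1/2) dW`. -/
structure IsVelocityEquilibrium (γ M D : Fin n → ℝ) (p : (Fin n → ℝ) → ℝ) : Prop where
  smooth : ContDiff ℝ 2 p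
  nonneg : ∀ r, 0 ≤ p r
  integrable : Integrable p
  total : ∫ r, p r = 1
  stationary : ∀ r, ∑ i, (partialDeriv i (fun q => γ i * q i * p q) r +
    partialDeriv i (fun q => D i / M i ^ 2 * partialDeriv i p q) r) = 0

/-- The equilibrium velocity `r_eq`: the root mean square of each velocity component under the
density `p`. -/
def rmsVelocity (p : (Fin n → ℝ) → ℝ) : Fin n → ℝ :=
  fun i => Real.sqrt (∫ r, r i ^ 2 * p r)

/-! ### The momentum drift -/

/-- The momentum drift is the motion `M ẍ = - γ M ẋ` (the motion equation without the random noise,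
with the gradient near the critical point neglected), started from the position `c` with the
velocity `r₀`. The matrices `M`, `γ` are diagonal in the frame `b`, and `r₀` is given by its
components in that frame. -/
structure IsMomentumDrift (b : OrthonormalBasis (Fin n) ℝ (Param n)) (γ M : Fin n → ℝ)
    (c : Param n) (r₀ : Fin n → ℝ) (x : ℝ → Param n) : Prop where
  smooth : ContDiff ℝ 2 x
  start : x 0 = c
  velocity : ∀ i, inner ℝ (b i) (deriv x 0) = r₀ i
  motion : ∀ t, 0 ≤ t → ∀ i,
    M i * inner ℝ (b i) (deriv (deriv x) t) = -(γ i * M i * inner ℝ (b i) (deriv x t))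

end AdaiDynamics

end

namespace AdaiDynamics

open ProbabilityTheory

/-! ### Products of centred Gaussian densities -/

/-! Since `γ i * M i = 1`, the exponent coefficient `β M` equals `M / D`, so the equilibrium density
is a product of centred Gaussians with variances `D i / M i` (`equilibriumDensity_eq_prod`), and
these are the squared equilibrium velocities. A damped coordinate travels its initial velocity
divided by `γ i` (`tendsto_sub_of_damped`), so the squared drift is `D i / (M i * γ i ^ 2) = D i / γ
i`. Both `D i` and `γ i` are proportional to `v i`, which cancels and leaves a value independent of
`i`. The mean of `v` is the trace of the covariance over `n`, hence independent of the frame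
(`sum_diagIn_absOperator`). -/

theorem integral_sq_mul_gaussianPDFReal {s : NNReal} (hs : s ≠ 0) :
    ∫ x, x ^ 2 * gaussianPDFReal 0 s x = s := by
  have h1 := variance_of_integral_eq_zero (μ := gaussianReal 0 s) (X := fun x : ℝ => x)
    measurable_id.aemeasurable integral_id_gaussianReal
  rw [variance_fun_id_gaussianReal, integral_gaussianReal_eq_integral_smul hs] at h1
  rw [h1]
  exact integral_congr_ae (Eventually.of_forall fun x => by simp [mul_comm])

variable {n : ℕ}

theorem integral_sq_mul_prod_gaussianPDFReal {s : Fin n → NNReal} (hs : ∀ i, s i ≠ 0)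
    (i : Fin n) :
    ∫ r : Fin n → ℝ, r i ^ 2 * ∏ j, gaussianPDFReal 0 (s j) (r j) = s i := by
  -- Absorbing `r i ^ 2` into the `i`-th factor gives a product of one-variable functions, to which
  -- Fubini applies.
  have hfun : ∀ r : Fin n → ℝ, r i ^ 2 * ∏ j, gaussianPDFReal 0 (s j) (r j) =
      ∏ j, (if j = i then (r j) ^ 2 else 1) * gaussianPDFReal 0 (s j) (r j) := fun r => by
    rw [Finset.prod_mul_distrib]
    simp
  simp_rw [hfun]
  rw [integral_fintype_prod_volume_eq_prod
    (f := fun j x => (if j = i then x ^ 2 else 1) * gaussianPDFReal 0 (s j) x)]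
  rw [Finset.prod_eq_single i]
  · simpa using integral_sq_mul_gaussianPDFReal (hs i)
  · intro j _ hj
    simpa [hj] using integral_gaussianPDFReal_eq_one 0 (hs j)
  · simp

theorem equilibriumDensity_eq_prod {γ M D : Fin n → ℝ} {s : Fin n → NNReal}
    (hs : ∀ i, invTemperature γ M D i * M i = (s i : ℝ)⁻¹) (r : Fin n → ℝ) :
    equilibriumDensity γ M D r = ∏ i, gaussianPDFReal 0 (s i) (r i) := by
  simp only [equilibriumDensity, hs, gaussianPDFReal_def, sub_zero]
  rw [Finset.prod_mul_distrib, ← Real.exp_sum]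
  congr 1
  · have h2 : ∀ i, (√(2 * Real.pi * s i))⁻¹ = (√(2 * Real.pi))⁻¹ * √((s i : ℝ)⁻¹) := fun i => by
      rw [Real.sqrt_mul (by positivity), mul_inv, Real.sqrt_inv]
    simp_rw [h2]
    rw [Finset.prod_mul_distrib, Real.sqrt_prod _ (fun i _ => by positivity)]
    congr 1
    rw [Finset.prod_const, Finset.card_univ, Fintype.card_fin, Real.sqrt_eq_rpow,
      ← Real.rpow_neg (by positivity), ← Real.rpow_mul_natCast (by positivity)]
    congr 1
    ring
  · congr 1
    rw [← Finset.sum_neg_distrib, Finset.sum_div]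
    refine Finset.sum_congr rfl fun i _ => ?_
    -- Zero variance is not excluded here: both exponents are then `0` by the convention for
    -- division by zero.
    by_cases h : (s i : ℝ) = 0
    · simp [h]
    · field_simp

theorem integral_equilibriumDensity {γ M D : Fin n → ℝ} {s : Fin n → NNReal}
    (hs : ∀ i, invTemperature γ M D i * M i = (s i : ℝ)⁻¹) (hs0 : ∀ i, s i ≠ 0) :
    ∫ r, equilibriumDensity γ M D r = 1 := by
  simp_rw [equilibriumDensity_eq_prod hs]
  rw [integral_fintype_prod_volume_eq_prod (f := fun j x => gaussianPDFReal 0 (s j) x)]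
  exact Finset.prod_eq_one fun i _ => integral_gaussianPDFReal_eq_one 0 (hs0 i)

theorem integrable_equilibriumDensity {γ M D : Fin n → ℝ} {s : Fin n → NNReal}
    (hs : ∀ i, invTemperature γ M D i * M i = (s i : ℝ)⁻¹) :
    Integrable (equilibriumDensity γ M D) := by
  rw [funext (equilibriumDensity_eq_prod hs)]
  exact Integrable.fintype_prod (f := fun i x => gaussianPDFReal 0 (s i) x)
    fun i => integrable_gaussianPDFReal 0 (s i)

theorem rmsVelocity_equilibriumDensity_sq {γ M D : Fin n → ℝ} {s : Fin n → NNReal}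
    (hs : ∀ i, invTemperature γ M D i * M i = (s i : ℝ)⁻¹) (hs0 : ∀ i, s i ≠ 0) (i : Fin n) :
    rmsVelocity (equilibriumDensity γ M D) i ^ 2 = s i := by
  simp only [rmsVelocity, equilibriumDensity_eq_prod hs]
  rw [integral_sq_mul_prod_gaussianPDFReal hs0, Real.sq_sqrt (NNReal.coe_nonneg _)]

/-! ### The Fokker-Planck equation -/

theorem partialDeriv_equilibriumDensity (γ M D : Fin n → ℝ) (i : Fin n) (r : Fin n → ℝ) :
    partialDeriv i (equilibriumDensity γ M D) r =
      -(invTemperature γ M D i * M i * r i * equilibriumDensity γ M D r) := by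
  have hu := hasDerivAt_pi.1 (hasDerivAt_update r i (r i))
  have hq : HasDerivAt
      (fun t => -(∑ j, invTemperature γ M D j * M j * Function.update r i t j ^ 2) / 2)
      (-(∑ j, invTemperature γ M D j * M j * (2 * r j * (Pi.single i 1 : Fin n → ℝ) j)) / 2)
      (r i) := by
    refine (HasDerivAt.fun_sum fun j _ => ?_).neg.div_const 2
    simpa using ((hu j).pow 2).const_mul (invTemperature γ M D j * M j)
  have hp := (hq.exp.const_mul ((2 * Real.pi) ^ (-((n : ℝ) / 2)) *
    Real.sqrt (∏ i, invTemperature γ M D i * M i))).deriv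
  unfold partialDeriv
  simp only [equilibriumDensity]
  rw [hp, Function.update_eq_self]
  simp only [Pi.single_apply, mul_ite, mul_one, mul_zero, Finset.sum_ite_eq', Finset.mem_univ,
    if_true]
  ring

/-- The hypothesis `hfd` is the fluctuation-dissipation relation: it makes the diffusive flux cancel
the friction flux in each coordinate, so the whole flux vanishes and not only its divergence. -/
theorem isVelocityEquilibrium_equilibriumDensity {γ M D : Fin n → ℝ} {s : Fin n → NNReal}
    (hs : ∀ i, invTemperature γ M D i * M i = (s i : ℝ)⁻¹) (hs0 : ∀ i, s i ≠ 0)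
    (hfd : ∀ i, D i / M i ^ 2 * (invTemperature γ M D i * M i) = γ i) :
    IsVelocityEquilibrium γ M D (equilibriumDensity γ M D) where
  smooth := by
    unfold equilibriumDensity
    fun_prop
  nonneg r := by
    unfold equilibriumDensity
    positivity
  integrable := integrable_equilibriumDensity hs
  total := integral_equilibriumDensity hs hs0
  stationary r := by
    refine Finset.sum_eq_zero fun i _ => ?_
    have hflux : (fun q => D i / M i ^ 2 * partialDeriv i (equilibriumDensity γ M D) q) =
        fun q => -(γ i * q i * equilibriumDensity γ M D q) := by
      funext q
      rw [partialDeriv_equilibriumDensity, ← hfd i]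
      ring
    rw [hflux]
    simp [partialDeriv, deriv.fun_neg]

/-! ### The damped motion -/

theorem hasDerivAt_exp_neg_mul (g t : ℝ) :
    HasDerivAt (fun t => Real.exp (-(g * t))) (-g * Real.exp (-(g * t))) t := by
  have := ((hasDerivAt_id t).const_mul g).neg.exp
  simp only [id, mul_one] at this
  rwa [mul_comm] at this

theorem tendsto_exp_neg_mul_atTop {g : ℝ} (hg : 0 < g) :
    Tendsto (fun t => Real.exp (-(g * t))) atTop (𝓝 0) :=
  Real.tendsto_exp_neg_atTop_nhds_zero.comp (tendsto_id.const_mul_atTop hg)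

/-- A solution of `f'' = -g f'` on `t ≥ 0` travels the total distance `f'(0) / g`. -/
theorem tendsto_sub_of_damped {f f' f'' : ℝ → ℝ} {g : ℝ} (hg : 0 < g)
    (hf : ∀ t, HasDerivAt f (f' t) t) (hf' : ∀ t, HasDerivAt f' (f'' t) t)
    (hdamp : ∀ t, 0 ≤ t → f'' t = -(g * f' t)) :
    Tendsto (fun t => f t - f 0) atTop (𝓝 (f' 0 / g)) := by
  have hconst : ∀ F F' : ℝ → ℝ, (∀ t, HasDerivAt F (F' t) t) → (∀ t, 0 ≤ t → F' t = 0) →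
      ∀ t, 0 ≤ t → F t = F 0 := fun F F' hF hF' t ht =>
    constant_of_has_deriv_right_zero (fun s _ => (hF s).continuousAt.continuousWithinAt)
      (fun s hs => by simpa [hF' s hs.1] using (hF s).hasDerivWithinAt) t ⟨ht, le_rfl⟩
  -- Two first integrals, `f' + g f` and `exp (g t) f'`, determine `f` on the half-line without a
  -- uniqueness theorem for ODEs.
  have h1 := hconst (fun t => f' t + g * f t) _ (fun t => (hf' t).add ((hf t).const_mul g))
    (fun t ht => by rw [hdamp t ht]; ring)
  have hexp : ∀ t, HasDerivAt (fun t => Real.exp (g * t)) (g * Real.exp (g * t)) t := fun t => by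
    simpa using hasDerivAt_exp_neg_mul (-g) t
  have h2 := hconst (fun t => Real.exp (g * t) * f' t) _ (fun t => (hexp t).mul (hf' t))
    (fun t ht => by rw [hdamp t ht]; ring)
  have hsol : (fun t => f' 0 / g * (1 - Real.exp (-(g * t)))) =ᶠ[atTop] fun t => f t - f 0 := by
    filter_upwards [eventually_ge_atTop 0] with t ht
    have e1 := h1 t ht
    have e2 := h2 t ht
    simp only [mul_zero, Real.exp_zero, one_mul] at e1 e2
    have e3 : f' t = f' 0 * Real.exp (-(g * t)) := by
      rw [← e2, mul_right_comm, ← Real.exp_add]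
      simp
    rw [e3] at e1
    field_simp
    linarith
  refine Tendsto.congr' hsol ?_
  simpa using ((tendsto_exp_neg_mul_atTop hg).const_sub 1).const_mul (f' 0 / g)

theorem IsMomentumDrift.tendsto_sq {b : OrthonormalBasis (Fin n) ℝ (Param n)}
    {γ M : Fin n → ℝ} {c : Param n} {r₀ : Fin n → ℝ} {x : ℝ → Param n}
    (hx : IsMomentumDrift b γ M c r₀ x) {i : Fin n} (hγ : 0 < γ i) (hM : M i ≠ 0) :
    Tendsto (fun t => (inner ℝ (b i) (x t - x 0)) ^ 2) atTop (𝓝 (r₀ i ^ 2 / γ i ^ 2)) := by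
  have hd : ∀ y : ℝ → Param n, Differentiable ℝ y →
      ∀ t, HasDerivAt (fun t => inner ℝ (b i) (y t)) (inner ℝ (b i) (deriv y t)) t :=
    fun y hy t => (innerSL ℝ (b i)).hasFDerivAt.comp_hasDerivAt t (hy t).hasDerivAt
  have hx1 : Differentiable ℝ x := hx.smooth.differentiable (by norm_num)
  have hx2 : Differentiable ℝ (deriv x) := by
    have : ContDiff ℝ (1 + 1) x := by simpa [one_add_one_eq_two] using hx.smooth
    exact (contDiff_succ_iff_deriv.1 this).2.2.differentiable one_ne_zero
  have h := tendsto_sub_of_damped hγ (hd x hx1) (hd _ hx2) fun t ht => by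
    refine mul_left_cancel₀ hM ?_
    rw [hx.motion t ht i]
    ring
  rw [hx.velocity i] at h
  simpa only [inner_sub_right, div_pow] using h.pow 2

theorem inner_sum_smul_basis (b : OrthonormalBasis (Fin n) ℝ (Param n)) (a : Fin n → ℝ)
    (i : Fin n) : inner ℝ (b i) (∑ j, a j • b j) = a i :=
  b.orthonormal.inner_right_fintype a i

theorem exists_isMomentumDrift (b : OrthonormalBasis (Fin n) ℝ (Param n)) {γ : Fin n → ℝ}
    (M : Fin n → ℝ) (c : Param n) (r₀ : Fin n → ℝ) (hγ : ∀ i, γ i ≠ 0) :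
    ∃ x : ℝ → Param n, IsMomentumDrift b γ M c r₀ x := by
  have h1 : deriv (fun t => c + ∑ j, (r₀ j / γ j * (1 - Real.exp (-(γ j * t)))) • b j) =
      fun t => ∑ j, (r₀ j * Real.exp (-(γ j * t))) • b j := by
    funext t
    refine HasDerivAt.deriv (HasDerivAt.const_add c (HasDerivAt.fun_sum fun j _ => ?_))
    refine HasDerivAt.smul_const ?_ (b j)
    convert! ((hasDerivAt_exp_neg_mul (γ j) t).const_sub 1).const_mul (r₀ j / γ j) using 1
    field_simp [hγ j]
  have h2 : deriv (fun t => ∑ j, (r₀ j * Real.exp (-(γ j * t))) • b j) =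
      fun t => ∑ j, (r₀ j * (-γ j * Real.exp (-(γ j * t)))) • b j := by
    funext t
    exact HasDerivAt.deriv (HasDerivAt.fun_sum fun j _ =>
      ((hasDerivAt_exp_neg_mul (γ j) t).const_mul (r₀ j)).smul_const (b j))
  -- The integral of the decaying velocity `r₀ j * exp (-(γ j * t))`, normalised to start at `c`; it
  -- is smooth on all of `ℝ`, as required.
  refine ⟨fun t => c + ∑ j, (r₀ j / γ j * (1 - Real.exp (-(γ j * t)))) • b j, ?_, ?_, ?_, ?_⟩
  · fun_prop
  · simp
  · intro i
    rw [h1, inner_sum_smul_basis]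
    simp
  · intro t _ i
    rw [h1, h2, inner_sum_smul_basis, inner_sum_smul_basis]
    ring

/-! ### The trace of the noise covariance -/

theorem diagIn_absOperator (b u : OrthonormalBasis (Fin n) ℝ (Param n)) (h : Fin n → ℝ)
    (i : Fin n) : diagIn b (absOperator u h) i = ∑ k, |h k| * inner ℝ (u k) (b i) ^ 2 := by
  simp only [diagIn, absOperator, sum_apply, smul_apply,
    ContinuousLinearMap.smulRight_apply, innerSL_apply_apply, inner_sum, real_inner_smul_right]
  refine Finset.sum_congr rfl fun k _ => ?_
  rw [real_inner_comm (u k) (b i)]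
  ring

/-- By Parseval in the frame `b`, each unit eigenvector `u k` contributes exactly `|h k|` to the
trace. -/
theorem sum_diagIn_absOperator (b u : OrthonormalBasis (Fin n) ℝ (Param n)) (h : Fin n → ℝ) :
    ∑ i, diagIn b (absOperator u h) i = ∑ k, |h k| := by
  simp_rw [diagIn_absOperator]
  rw [Finset.sum_comm]
  refine Finset.sum_congr rfl fun k _ => ?_
  rw [← Finset.mul_sum, b.sum_sq_inner_left, u.orthonormal.norm_eq_one]
  simp

theorem diagIn_smul (b : OrthonormalBasis (Fin n) ℝ (Param n)) (a : ℝ)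
    (T : Param n →L[ℝ] Param n) (i : Fin n) : diagIn b (a • T) i = a * diagIn b T i := by
  simp [diagIn, real_inner_smul_right]

theorem mean_diagIn_noiseCovariance (B : ℕ) (b u : OrthonormalBasis (Fin n) ℝ (Param n))
    (h : Fin n → ℝ) :
    mean (diagIn b (noiseCovariance B u h)) = (∑ k, |h k|) / (B * n) := by
  simp only [mean, noiseCovariance, diagIn_smul]
  rw [← Finset.mul_sum, sum_diagIn_absOperator, inv_mul_eq_div, div_div]

end AdaiDynamics

theorem mainTheorem8 {n : ℕ} (L : AdaiDynamics.Param n → ℝ) (c : AdaiDynamics.Param n)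
    (hcrit : AdaiDynamics.IsCriticalPoint L c)
    (htaylor : AdaiDynamics.IsQuadraticNear L c)
    -- eigenvectors and eigenvalues of the Hessian at the critical point
    (u : OrthonormalBasis (Fin n) ℝ (AdaiDynamics.Param n)) (h : Fin n → ℝ)
    (heig : AdaiDynamics.IsEigendecomposition (AdaiDynamics.hessian L c) u h)
    -- the frame of the element-wise operations of the optimizer
    (b : OrthonormalBasis (Fin n) ℝ (AdaiDynamics.Param n))
    -- learning rate, inertia hyperparameter, batch size
    (η β₀ : ℝ) (hη : 0 < η) (hβ₀ : 0 < β₀) (B : ℕ) (hB : 0 < B)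
    -- gradient noise covariance, second moments, diffusion, inertia, mass and damping
    (C : AdaiDynamics.Param n →L[ℝ] AdaiDynamics.Param n)
    (hC : C = AdaiDynamics.noiseCovariance B u h)
    (v D β₁ M γ : Fin n → ℝ)
    (hv : v = AdaiDynamics.diagIn b C)
    (hD : D = AdaiDynamics.diagIn b (AdaiDynamics.diffusion η C))
    (hβ₁ : β₁ = AdaiDynamics.inertia β₀ v)
    (hM : M = AdaiDynamics.mass η β₁)
    (hγ : γ = AdaiDynamics.damping η β₁)
    (hpos : ∀ i, 0 < v i) :
    AdaiDynamics.IsVelocityEquilibrium γ M D (AdaiDynamics.equilibriumDensity γ M D) ∧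
    (∃ x : ℝ → AdaiDynamics.Param n, AdaiDynamics.IsMomentumDrift b γ M c
      (AdaiDynamics.rmsVelocity (AdaiDynamics.equilibriumDensity γ M D)) x) ∧
    (∀ x : ℝ → AdaiDynamics.Param n, AdaiDynamics.IsMomentumDrift b γ M c
      (AdaiDynamics.rmsVelocity (AdaiDynamics.equilibriumDensity γ M D)) x →
      ∀ i, Tendsto (fun t => (inner ℝ (b i) (x t - x 0)) ^ 2) atTop
        (𝓝 (AdaiDynamics.mean v * η ^ 2 / (2 * β₀)))) ∧
    AdaiDynamics.mean v * η ^ 2 / (2 * β₀) =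
      (∑ k, |h k|) * η ^ 2 / (2 * β₀ * n * B) := by
  have hD' : ∀ i, D i = η / 2 * v i := fun i => by
    rw [hD, hv, AdaiDynamics.diffusion, AdaiDynamics.diagIn_smul]
  -- The index only witnesses `n ≠ 0`.
  have hmean : ∀ _ : Fin n, 0 < AdaiDynamics.mean v := fun i => by
    have hn : (0 : ℝ) < n := Nat.cast_pos.2 i.pos
    exact div_pos (Finset.sum_pos (fun j _ => hpos j) ⟨i, Finset.mem_univ i⟩) hn
  have ha : ∀ i, 1 - β₁ i = β₀ / AdaiDynamics.mean v * v i := fun i => by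
    rw [hβ₁, AdaiDynamics.inertia]
    ring
  have hM' : ∀ i, M i = η * (β₀ / AdaiDynamics.mean v * v i)⁻¹ := fun i => by
    rw [hM, AdaiDynamics.mass, ha]
  have hγ' : ∀ i, γ i = η⁻¹ * (β₀ / AdaiDynamics.mean v * v i) := fun i => by
    rw [hγ, AdaiDynamics.damping, ha]
  have hM0 : ∀ i, 0 < M i := fun i => by
    have := hmean i
    have := hpos i
    rw [hM']
    positivity
  have hD0 : ∀ i, 0 < D i := fun i => by
    have := hpos i
    rw [hD']
    positivity
  have hγ0 : ∀ i, 0 < γ i := fun i => by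
    have := hmean i
    have := hpos i
    rw [hγ']
    positivity
  have hγM : ∀ i, γ i * M i = 1 := fun i => by
    have := hmean i
    have := hpos i
    rw [hγ', hM']
    field_simp
  have hβ : ∀ i, AdaiDynamics.invTemperature γ M D i * M i = M i / D i := fun i => by
    rw [AdaiDynamics.invTemperature, hγM]
    ring
  let s : Fin n → NNReal := fun i => ⟨D i / M i, (div_pos (hD0 i) (hM0 i)).le⟩
  have hs : ∀ i, AdaiDynamics.invTemperature γ M D i * M i = (s i : ℝ)⁻¹ := fun i => by
    rw [hβ]
    exact (inv_div _ _).symm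
  have hs0 : ∀ i, s i ≠ 0 := fun i =>
    NNReal.coe_ne_zero.1 (div_pos (hD0 i) (hM0 i)).ne'
  refine ⟨AdaiDynamics.isVelocityEquilibrium_equilibriumDensity hs hs0 fun i => ?_,
    AdaiDynamics.exists_isMomentumDrift b M c _ fun i => (hγ0 i).ne', fun x hx i => ?_, ?_⟩
  · have h1 := hM0 i
    have h2 := hD0 i
    rw [hβ, ← mul_right_cancel_iff_of_pos h1, hγM]
    field_simp
  · have h1 := hx.tendsto_sq (hγ0 i) (hM0 i).ne'
    rw [AdaiDynamics.rmsVelocity_equilibriumDensity_sq hs hs0] at h1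
    -- It remains to compare the limits; `v i` cancels in `D i / M i / γ i ^ 2`.
    convert! h1 using 2
    have h2 := hmean i
    have h3 := hpos i
    change _ = D i / M i / γ i ^ 2
    rw [hD', hM', hγ']
    field_simp
  · rw [hv, hC, AdaiDynamics.mean_diagIn_noiseCovariance, div_mul_eq_mul_div, div_div]
    congr 1
    ring
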